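/- **Theorem.** Let $m,n\ge 0$ be integers. There is $p_0=p_0(m,n)$ such that for every prime $p\ge p_0$ the following holds. Let $\mathcal P$ be the set of polynomials $Q\in\mathbb F_p[X_1,\dots,X_m]$ of total degree at most $n$ with zero constant term. A function $B:\mathbb F_p^{m}\times\mathbb F_p\to\mathbb F_p$ *hides* $Q\in\mathcal P$ if, for all $r,\bar r\in\mathbb F_p^m$ and $s,\bar s\in\mathbb F_p$, $B(r,s)=B(\bar r,\bar s)$ if and only if there is $z\in\mathbb F_p$ with $s=Q(r)+z$ and $\bar s=Q(\bar r)+z$. 1. The quantum query complexity of the Hidden Polynomial Function Graph Problem is at most $4\binom{n+m}{m}$. That is, some quantum algorithm that makes at most $4\binom{n+m}{m}$ queries $|x\rangle|y\rangle\mapsto|x\rangle|y+B(x)\rangle$ (with $x\in\mathbb F_p^{m+1}$, $y\in\mathbb F_p$), interleaved with unitaries on the query registers and a finite workspace that do not depend on $B$, and followed by a final measurement, outputs $Q$ with probability at least $1/2$, for every $Q\in\mathcal P$ and every $B$ that hides $Q$. 2. For $Q\in\mathcal P$ let $$\rho_Q=\frac1p\sum_{z\in\mathbb F_p}|\phi_{Q,z}\rangle\langle\phi_{Q,z}|,\qquad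 |\phi_{Q,z}\rangle=\frac1{\sqrt{p^m}}\sum_{r\in\mathbb F_p^m}|r\rangle\otimes|Q(r)+z\rangle$$ be the polynomial function states, and let $k=4\binom{n+m}{m}$. There is a POVM $\{E_Q\}_{Q\in\mathcal P}$ on $k$ copies of these states such that $$\min_{Q\in\mathcal P}\operatorname{Tr}\bigl(\rho_Q^{\otimes k}E_Q\bigr)\ge\frac12 .$$ -/

import Mathlib

/-! ### Finite-dimensional quantum mechanics -/

open scoped ComplexOrder in
/-- A POVM on the finite-dimensional Hilbert space `ℂ^ι` with outcomes in the finite type `Ω`. -/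
structure POVM (ι Ω : Type) [Fintype ι] [DecidableEq ι] [Fintype Ω] where
  effect : Ω → Matrix ι ι ℂ
  posSemidef : ∀ ω, (effect ω).PosSemidef
  sum_eq_one : ∑ ω, effect ω = 1

/-- The probability `Tr(ρ E_ω)` of the outcome `ω` when a POVM is applied to the state `ρ`. -/
noncomputable def POVM.prob {ι Ω : Type} [Fintype ι] [DecidableEq ι] [Fintype Ω]
    (E : POVM ι Ω) (ρ : Matrix ι ι ℂ) (ω : Ω) : ℝ :=
  (Matrix.trace (ρ * E.effect ω)).re

/-- The rank-one operator `|ψ⟩⟨ψ|`. -/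
def ketBra {ι : Type} (ψ : ι → ℂ) : Matrix ι ι ℂ :=
  Matrix.vecMulVec ψ (star ψ)

/-- The `k`-fold tensor power `ρ^{⊗k}`, an operator on `(ℂ^ι)^{⊗k} = ℂ^(Fin k → ι)`. -/
def tensorPower {ι : Type} (k : ℕ) (ρ : Matrix ι ι ℂ) : Matrix (Fin k → ι) (Fin k → ι) ℂ :=
  Matrix.of fun a b => ∏ i, ρ (a i) (b i)

/-! ### Quantum query algorithms -/

/-- A quantum algorithm with black-box access to a function `X → Y` and with outputs in `Ω`.
Its Hilbert space is spanned by the basis states `|x⟩ ⊗ |y⟩ ⊗ |w⟩`, where `x : X` is the query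
register, `y : Y` the answer register and `w` ranges over an arbitrary finite workspace.  It
starts in a basis state, alternates unitaries that do not depend on the black box (`unitary 0`,
..., `unitary queries`) with `queries` calls of the black box, and is ended by a measurement. -/
structure QueryAlgorithm (X Y Ω : Type) [Fintype X] [DecidableEq X] [Fintype Y] [DecidableEq Y]
    [Fintype Ω] where
  Work : Type
  [fintypeWork : Fintype Work]
  [decidableEqWork : DecidableEq Work]
  queries : ℕ
  start : X × Y × Work
  unitary : ℕ → Matrix.unitaryGroup (X × Y × Work) ℂ
  measurement : POVM (X × Y × Work) Ω

attribute [instance] QueryAlgorithm.fintypeWork QueryAlgorithm.decidableEqWork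

/-- One call of the black box `B`: the linear extension of
`|x⟩ ⊗ |y⟩ ⊗ |w⟩ ↦ |x⟩ ⊗ |y + B x⟩ ⊗ |w⟩`. -/
def queryOp {X Y W : Type} [AddGroup Y] (B : X → Y) (ψ : X × Y × W → ℂ) : X × Y × W → ℂ :=
  fun a => ψ (a.1, a.2.1 - B a.1, a.2.2)

namespace QueryAlgorithm

variable {X Y Ω : Type} [Fintype X] [DecidableEq X] [Fintype Y] [DecidableEq Y] [AddGroup Y]
  [Fintype Ω]

/-- The state vector after `j` calls of the black box `B` (and the unitary that follows). -/
noncomputable def stateAfter (A : QueryAlgorithm X Y Ω) (B : X → Y) :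
    ℕ → (X × Y × A.Work → ℂ)
  | 0 => (A.unitary 0 : Matrix _ _ ℂ).mulVec (Pi.single A.start 1)
  | j + 1 => (A.unitary (j + 1) : Matrix _ _ ℂ).mulVec (queryOp B (A.stateAfter B j))

/-- The probability that the algorithm outputs `ω` when it is run with the black box `B`. -/
noncomputable def outputProb (A : QueryAlgorithm X Y Ω) (B : X → Y) (ω : Ω) : ℝ :=
  A.measurement.prob (ketBra (A.stateAfter B A.queries)) ω

end QueryAlgorithm

/-! ### The Hidden Polynomial Function Graph Problem -/

/-- The polynomials in `𝔽_p[X₁, …, X_m]` of total degree at most `n` with constant term zero. -/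
def HiddenPoly (p m n : ℕ) : Type :=
  {Q : MvPolynomial (Fin m) (ZMod p) // Q.totalDegree ≤ n ∧ MvPolynomial.constantCoeff Q = 0}

/-- The value `Q(r₁, …, r_m)`. -/
noncomputable def HiddenPoly.eval {p m n : ℕ} (Q : HiddenPoly p m n) (r : Fin m → ZMod p) :
    ZMod p :=
  MvPolynomial.eval r Q.1

instance HiddenPoly.instFinite (p m n : ℕ) [Fact p.Prime] : Finite (HiddenPoly p m n) := by
  have hS : {d : Fin m →₀ ℕ | d.degree ≤ n}.Finite := Finsupp.finite_of_degree_le n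
  have : Finite {d : Fin m →₀ ℕ | d.degree ≤ n} := hS
  refine Finite.of_injective
    (fun (Q : HiddenPoly p m n) (d : {d : Fin m →₀ ℕ | d.degree ≤ n}) =>
      MvPolynomial.coeff d.1 Q.1) ?_
  intro Q R h
  apply Subtype.ext
  ext d
  by_cases hd : d.degree ≤ n
  · exact congrFun h ⟨d, hd⟩
  · have hd' : n < ∑ i ∈ d.support, d i := not_le.mp hd
    rw [MvPolynomial.coeff_eq_zero_of_totalDegree_lt (lt_of_le_of_lt Q.2.1 hd'),
      MvPolynomial.coeff_eq_zero_of_totalDegree_lt (lt_of_le_of_lt R.2.1 hd')]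

noncomputable instance HiddenPoly.instFintype (p m n : ℕ) [Fact p.Prime] :
    Fintype (HiddenPoly p m n) :=
  Fintype.ofFinite _

/-- The points `(r₁, …, r_m, s)` of `𝔽_p^(m+1)`, written as pairs `(r, s)`. -/
abbrev GraphSpace (p m : ℕ) : Type := (Fin m → ZMod p) × ZMod p

/-- The black-box function `B : 𝔽_p^(m+1) → 𝔽_p` hides the polynomial `Q`: it is constant on the
translated graphs `{(r, Q(r) + z)}` and distinct for different values of `z`. -/
def Hides {p m n : ℕ} (B : GraphSpace p m → ZMod p) (Q : HiddenPoly p m n) : Prop :=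
  ∀ (r : Fin m → ZMod p) (s : ZMod p) (r' : Fin m → ZMod p) (s' : ZMod p),
    B (r, s) = B (r', s') ↔ ∃ z : ZMod p, s = Q.eval r + z ∧ s' = Q.eval r' + z

/-- The algorithm identifies the hidden polynomial with probability at least `1/2`, for every
polynomial and every black-box function that hides it. -/
def SolvesHiddenPoly {p m n : ℕ} [Fact p.Prime]
    (A : QueryAlgorithm (GraphSpace p m) (ZMod p) (HiddenPoly p m n)) : Prop :=
  ∀ (Q : HiddenPoly p m n) (B : GraphSpace p m → ZMod p), Hides B Q → 1 / 2 ≤ A.outputProb B Q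

/-- The quantum query complexity of the Hidden Polynomial Function Graph Problem: the least number
of queries of a quantum algorithm that solves it (`⊤` if there were none). -/
noncomputable def quantumQueryComplexity (p m n : ℕ) [Fact p.Prime] : ℕ∞ :=
  ⨅ (A : QueryAlgorithm (GraphSpace p m) (ZMod p) (HiddenPoly p m n)) (_ : SolvesHiddenPoly A),
    (A.queries : ℕ∞)

/-- The state vector `|φ_{Q,z}⟩ = p^(-m/2) ∑_r |r⟩ ⊗ |Q(r) + z⟩`. -/
noncomputable def graphKet {p m n : ℕ} (Q : HiddenPoly p m n) (z : ZMod p) :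
    GraphSpace p m → ℂ :=
  fun a => if a.2 = Q.eval a.1 + z then ((1 / Real.sqrt ((p : ℝ) ^ m) : ℝ) : ℂ) else 0

/-- The polynomial function state `ρ_Q = (1/p) ∑_z |φ_{Q,z}⟩⟨φ_{Q,z}|`. -/
noncomputable def polyState {p m n : ℕ} [Fact p.Prime] (Q : HiddenPoly p m n) :
    Matrix (GraphSpace p m) (GraphSpace p m) ℂ :=
  (1 / (p : ℂ)) • ∑ z : ZMod p, ketBra (graphKet Q z)

/-!
# Identifying a hidden polynomial from copies of its function state

Let `D = (n + m).choose m`, so that there are at most `p ^ D` candidate polynomials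
(`card_hiddenPoly_le`).

*From the black box to the states.*  A query on the uniform superposition of all `|x⟩|0⟩` gives
`∑ₓ |x⟩|B x⟩`.  If `B` hides `Q`, the level sets of `B` are the translates of the graph of `Q`, so
tracing out the answer register leaves exactly the state `ρ_Q`.  A query algorithm can therefore
produce `k` copies of `ρ_Q` with `k` queries, storing each answered query in its own slot of the
workspace, and apply any POVM to them; the outcome probabilities agree with those of the POVM on
`ρ_Q^{⊗k}` (`Hides.outputProb_eq_prob_tensorPower`).  Only the POVM remains to be found.

*The POVM.*  `ρ_Q^{⊗k}` is the uniform mixture of the orthonormal vectors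
`ψ = |φ_{Q,z₁}⟩ ⊗ ⋯ ⊗ |φ_{Q,z_k}⟩`; let `P_Q` be the projection onto their span.  For `R ≠ Q`, the
overlap of `φ_{Q,z}` and `φ_{R,y}` is the fraction of points at which `Q + z` and `R + y` agree,
which is at most `n / p` by the Schwartz-Zippel lemma.  For fixed `z` these fractions sum to `1`
over `y`, so the sum of their squares is at most `n / p`, and hence `‖P_R ψ‖ ≤ (n / p) ^ (k / 2)`
(`l2norm_graphProj_mulVec_le`).

Measure the projections `P_R` one after the other and report the first one that accepts.  On the
way to `P_Q` each rejected projection `P_R` moves the state away from `ψ` by at most `‖P_R ψ‖`, so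
the amplitude of the correct outcome is at least `1 - ∑_{R ≠ Q} ‖P_R ψ‖`
(`exists_povm_of_projections`).  With `k = 4 * D` copies the sum is at most
`p ^ D * (n / p) ^ (2 * D) = n ^ (2 * D) / p ^ D`, which is at most `1 / 4` for large `p`.
-/

open Matrix

/-! ### Euclidean norms and outcome probabilities of pure states -/

/-- The Euclidean norm of a vector of `ℂ^ι` that is given as a plain function. -/
noncomputable def l2norm {ι : Type} [Fintype ι] (v : ι → ℂ) : ℝ := ‖WithLp.toLp 2 v‖

section L2

variable {ι : Type} [Fintype ι]

lemma l2norm_nonneg (v : ι → ℂ) : 0 ≤ l2norm v := norm_nonneg _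

lemma l2norm_sub_le (v w : ι → ℂ) : l2norm (v - w) ≤ l2norm v + l2norm w := by
  simpa [l2norm] using norm_sub_le (WithLp.toLp 2 v) (WithLp.toLp 2 w)

lemma l2norm_le_add_sub (v w : ι → ℂ) : l2norm v ≤ l2norm w + l2norm (w - v) := by
  simpa using l2norm_sub_le w (w - v)

lemma l2norm_sq (v : ι → ℂ) : l2norm v ^ 2 = (star v ⬝ᵥ v).re := by
  rw [l2norm, EuclideanSpace.norm_sq_eq]
  simp [dotProduct, Complex.sq_norm, Complex.normSq_apply]

lemma star_mulVec_dotProduct_mulVec (A : Matrix ι ι ℂ) (v : ι → ℂ) :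
    star (A *ᵥ v) ⬝ᵥ (A *ᵥ v) = star v ⬝ᵥ ((Aᴴ * A) *ᵥ v) := by
  rw [star_mulVec, ← dotProduct_mulVec, mulVec_mulVec]

lemma IsStarProjection.l2norm_mulVec_sq {P : Matrix ι ι ℂ} (hP : IsStarProjection P)
    (v : ι → ℂ) : l2norm (P *ᵥ v) ^ 2 = (star v ⬝ᵥ (P *ᵥ v)).re := by
  have h : Pᴴ = P := hP.isSelfAdjoint
  rw [l2norm_sq, star_mulVec_dotProduct_mulVec, h, hP.isIdempotentElem.eq]

lemma trace_ketBra_mul (ψ : ι → ℂ) (M : Matrix ι ι ℂ) :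
    trace (ketBra ψ * M) = star ψ ⬝ᵥ (M *ᵥ ψ) := by
  rw [ketBra, vecMulVec_mul, trace_vecMulVec, dotProduct_mulVec, dotProduct_comm]

variable [DecidableEq ι]

lemma IsStarProjection.l2norm_mulVec_le {P : Matrix ι ι ℂ} (hP : IsStarProjection P)
    (v : ι → ℂ) : l2norm (P *ᵥ v) ≤ l2norm v := by
  refine le_of_sq_le_sq ?_ (l2norm_nonneg v)
  have h := sq_nonneg (l2norm ((1 - P) *ᵥ v))
  rw [hP.one_sub.l2norm_mulVec_sq, sub_mulVec, one_mulVec, dotProduct_sub, Complex.sub_re] at h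
  rw [hP.l2norm_mulVec_sq, l2norm_sq]
  linarith

lemma POVM.prob_ketBra {Ω : Type} [Fintype Ω] (E : POVM ι Ω) (ψ : ι → ℂ) (ω : Ω) :
    E.prob (ketBra ψ) ω = (star ψ ⬝ᵥ (E.effect ω *ᵥ ψ)).re := by
  rw [POVM.prob, trace_ketBra_mul]

open scoped ComplexOrder in
lemma POVM.prob_ketBra_nonneg {Ω : Type} [Fintype Ω] (E : POVM ι Ω) (ψ : ι → ℂ) (ω : Ω) :
    0 ≤ E.prob (ketBra ψ) ω := by
  rw [E.prob_ketBra]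
  exact (Complex.le_def.1 ((E.posSemidef ω).dotProduct_mulVec_nonneg ψ)).1

end L2

/-! ### Sequential measurement of projections -/

section Sequential

variable {ι Ω : Type} [Fintype ι] [DecidableEq ι] [Fintype Ω]

open scoped ComplexOrder in
open Classical in
/-- The POVM that first measures the projection `P`, reports `a` if the outcome is positive, and
otherwise applies `E` to the state that is left. -/
noncomputable def POVM.precede (E : POVM ι Ω) {P : Matrix ι ι ℂ} (hP : IsStarProjection P)
    (a : Ω) : POVM ι Ω where
  effect ω := (if ω = a then P else 0) + (1 - P)ᴴ * E.effect ω * (1 - P)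
  posSemidef ω := by
    refine PosSemidef.add ?_ ((E.posSemidef ω).conjTranspose_mul_mul_same _)
    split_ifs
    · have h : Pᴴ = P := hP.isSelfAdjoint
      have h' := posSemidef_conjTranspose_mul_self P
      rwa [h, hP.isIdempotentElem.eq] at h'
    · exact PosSemidef.zero
  sum_eq_one := by
    have h : (1 - P)ᴴ = 1 - P := hP.one_sub.isSelfAdjoint
    rw [Finset.sum_add_distrib, ← Finset.sum_mul, ← Finset.mul_sum, E.sum_eq_one, h, mul_one,
      hP.one_sub.isIdempotentElem.eq]
    simp

lemma POVM.prob_precede (E : POVM ι Ω) {P : Matrix ι ι ℂ} (hP : IsStarProjection P) (a ω : Ω)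
    [Decidable (ω = a)] (φ : ι → ℂ) : (E.precede hP a).prob (ketBra φ) ω =
      (if ω = a then l2norm (P *ᵥ φ) ^ 2 else 0) + E.prob (ketBra ((1 - P) *ᵥ φ)) ω := by
  have key : star φ ⬝ᵥ (((1 - P)ᴴ * E.effect ω * (1 - P)) *ᵥ φ) =
      star ((1 - P) *ᵥ φ) ⬝ᵥ (E.effect ω *ᵥ ((1 - P) *ᵥ φ)) := by
    rw [star_mulVec, ← dotProduct_mulVec, mulVec_mulVec, mulVec_mulVec, mul_assoc]
  rw [POVM.prob_ketBra, POVM.prob_ketBra]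
  simp only [POVM.precede, add_mulVec, dotProduct_add, Complex.add_re, key]
  congr 1
  split_ifs
  · rw [hP.l2norm_mulVec_sq]
  · simp

open scoped ComplexOrder in
open Classical in
/-- The POVM that always reports `a`. -/
noncomputable def POVM.const (ι : Type) [Fintype ι] [DecidableEq ι] (a : Ω) : POVM ι Ω where
  effect ω := if ω = a then 1 else 0
  posSemidef ω := by
    split_ifs
    exacts [PosSemidef.one, PosSemidef.zero]
  sum_eq_one := by simp

open Classical in
/-- The induction behind the sequential measurement.  The state `φ` that reaches the measurement
may already differ from the vector `ψ` in the range of `P ω`; each projection that is measured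
before `P ω` moves the state away from `ψ` by at most another `‖P ω' ψ‖`. -/
lemma exists_povm_sequential [Nonempty Ω] {P : Ω → Matrix ι ι ℂ}
    (hP : ∀ ω, IsStarProjection (P ω)) (s : Finset Ω) :
    ∃ E : POVM ι Ω, ∀ ω ∈ s, ∀ ψ φ : ι → ℂ, P ω *ᵥ ψ = ψ →
      l2norm ψ - l2norm (φ - ψ) - ∑ ω' ∈ s.erase ω, l2norm (P ω' *ᵥ ψ) ≤
        √(E.prob (ketBra φ) ω) := by
  induction s using Finset.induction_on with
  | empty => exact ⟨POVM.const ι (Classical.arbitrary Ω), by simp⟩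
  | insert a s ha ih =>
    obtain ⟨E, hE⟩ := ih
    refine ⟨E.precede (hP a) a, fun ω hω ψ φ hψ => ?_⟩
    rw [POVM.prob_precede]
    by_cases h : ω = a
    · subst h
      have h1 : l2norm ψ ≤ l2norm (P ω *ᵥ φ) + l2norm (φ - ψ) := by
        refine (l2norm_le_add_sub ψ (P ω *ᵥ φ)).trans ?_
        gcongr
        conv_lhs => rw [← hψ, ← mulVec_sub]
        exact (hP ω).l2norm_mulVec_le _
      have h2 : 0 ≤ ∑ ω' ∈ (insert ω s).erase ω, l2norm (P ω' *ᵥ ψ) :=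
        Finset.sum_nonneg fun _ _ => l2norm_nonneg _
      rw [if_pos rfl]
      refine le_trans ?_ (Real.le_sqrt_of_sq_le
        (le_add_of_nonneg_right (E.prob_ketBra_nonneg _ _)) : l2norm (P ω *ᵥ φ) ≤ _)
      linarith
    · have hs : ω ∈ s := Finset.mem_of_mem_insert_of_ne hω h
      rw [if_neg h, zero_add]
      refine le_trans ?_ (hE ω hs ψ ((1 - P a) *ᵥ φ) hψ)
      have h1 : l2norm ((1 - P a) *ᵥ φ - ψ) ≤ l2norm (φ - ψ) + l2norm (P a *ᵥ ψ) := by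
        have : (1 - P a) *ᵥ φ - ψ = (1 - P a) *ᵥ (φ - ψ) - P a *ᵥ ψ := by
          simp only [sub_mulVec, one_mulVec, mulVec_sub]
          abel
        rw [this]
        refine (l2norm_sub_le _ _).trans ?_
        gcongr
        exact (hP a).one_sub.l2norm_mulVec_le _
      have h2 : (insert a s).erase ω = insert a (s.erase ω) :=
        Finset.erase_insert_of_ne (Ne.symm h)
      rw [h2, Finset.sum_insert (fun h' => ha (Finset.mem_of_mem_erase h'))]
      linarith

open Classical in
/-- Sequential measurement of a finite family of projections identifies every unit vector in the
range of one of them with probability at least `1/2`, provided that the other projections of this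
vector are short in total. -/
theorem exists_povm_of_projections [Nonempty Ω] {P : Ω → Matrix ι ι ℂ}
    (hP : ∀ ω, IsStarProjection (P ω)) :
    ∃ E : POVM ι Ω, ∀ ω, ∀ ψ : ι → ℂ, P ω *ᵥ ψ = ψ → l2norm ψ = 1 →
      ∑ ω' ∈ Finset.univ.erase ω, l2norm (P ω' *ᵥ ψ) ≤ 1 / 4 →
        1 / 2 ≤ E.prob (ketBra ψ) ω := by
  obtain ⟨E, hE⟩ := exists_povm_sequential hP Finset.univ
  refine ⟨E, fun ω ψ hψ h1 hsum => ?_⟩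
  have h := hE ω (Finset.mem_univ _) ψ ψ hψ
  have h0 : l2norm (ψ - ψ) = 0 := by simp [l2norm]
  rw [h1, h0] at h
  have h3 : 3 / 4 ≤ √(E.prob (ketBra ψ) ω) := by linarith
  have h4 := Real.sq_sqrt (E.prob_ketBra_nonneg ψ ω)
  nlinarith

end Sequential

/-! ### Orthonormal families and tensor products -/

section Orthonormal

variable {ι κ : Type}

lemma ketBra_mulVec [Fintype ι] (ψ v : ι → ℂ) : ketBra ψ *ᵥ v = (star ψ ⬝ᵥ v) • ψ := by
  ext i
  simp [ketBra, vecMulVec_mulVec, mul_comm]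

/-- The projection onto the span of a finite orthonormal family. -/
lemma isStarProjection_sum_ketBra [Fintype ι] [Fintype κ] [DecidableEq κ] {f : κ → ι → ℂ}
    (hf : ∀ y z, star (f y) ⬝ᵥ f z = if y = z then 1 else 0) :
    IsStarProjection (∑ z, ketBra (f z)) where
  isIdempotentElem := by
    rw [IsIdempotentElem, Finset.sum_mul_sum]
    refine Finset.sum_congr rfl fun y _ => ?_
    rw [Finset.sum_eq_single y _ (by simp)]
    · simp [ketBra, vecMulVec_mul_vecMulVec, hf]
    · intro z _ hz
      simp [ketBra, vecMulVec_mul_vecMulVec, hf, hz.symm]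
  isSelfAdjoint := by
    rw [IsSelfAdjoint, star_sum]
    refine Finset.sum_congr rfl fun y _ => ?_
    simp [ketBra, star_eq_conjTranspose, conjTranspose_vecMulVec]

lemma sum_ketBra_mulVec_self [Fintype ι] [Fintype κ] [DecidableEq κ] {f : κ → ι → ℂ}
    (hf : ∀ y z, star (f y) ⬝ᵥ f z = if y = z then 1 else 0) (z : κ) :
    (∑ y, ketBra (f y)) *ᵥ f z = f z := by
  simp [sum_mulVec, ketBra_mulVec, hf]

lemma l2norm_sum_ketBra_mulVec_sq [Fintype ι] [DecidableEq ι] [Fintype κ] [DecidableEq κ]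
    {f : κ → ι → ℂ}
    (hf : ∀ y z, star (f y) ⬝ᵥ f z = if y = z then 1 else 0) (v : ι → ℂ) :
    l2norm ((∑ y, ketBra (f y)) *ᵥ v) ^ 2 = ∑ y, ‖star (f y) ⬝ᵥ v‖ ^ 2 := by
  rw [(isStarProjection_sum_ketBra hf).l2norm_mulVec_sq, sum_mulVec, dotProduct_sum,
    Complex.re_sum]
  refine Finset.sum_congr rfl fun y _ => ?_
  have h : star v ⬝ᵥ f y = star (star (f y) ⬝ᵥ v) := by
    rw [star_dotProduct]
  rw [ketBra_mulVec, dotProduct_smul, h, smul_eq_mul, Complex.star_def, Complex.mul_conj,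
    Complex.ofReal_re, Complex.normSq_eq_norm_sq]

/-- The product vector `v₁ ⊗ ⋯ ⊗ v_k` in `(ℂ^ι)^{⊗k} = ℂ^(Fin k → ι)`. -/
def tensorKet {k : ℕ} (v : Fin k → ι → ℂ) : (Fin k → ι) → ℂ := fun a => ∏ i, v i (a i)

lemma star_tensorKet_dotProduct [Fintype ι] {k : ℕ} (v w : Fin k → ι → ℂ) :
    star (tensorKet v) ⬝ᵥ tensorKet w = ∏ i, (star (v i) ⬝ᵥ w i) := by
  simp only [dotProduct, Finset.prod_univ_sum, Fintype.piFinset_univ, tensorKet, Pi.star_apply,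
    star_prod, Finset.prod_mul_distrib]

lemma star_tensorKet_dotProduct_of_orthonormal [Fintype ι] [DecidableEq κ] {f : κ → ι → ℂ}
    (hf : ∀ y z, star (f y) ⬝ᵥ f z = if y = z then 1 else 0) {k : ℕ} (y z : Fin k → κ) :
    star (tensorKet fun i => f (y i)) ⬝ᵥ (tensorKet fun i => f (z i)) =
      if y = z then 1 else 0 := by
  simp only [star_tensorKet_dotProduct, hf, Finset.prod_ite_zero, Finset.mem_univ, true_imp_iff,
    Finset.prod_const_one, funext_iff]

lemma tensorPower_smul_sum_ketBra [Fintype κ] (c : ℂ) (f : κ → ι → ℂ) (k : ℕ) :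
    tensorPower k (c • ∑ z, ketBra (f z)) =
      c ^ k • ∑ z : Fin k → κ, ketBra (tensorKet fun i => f (z i)) := by
  ext a b
  simp only [tensorPower, of_apply, Matrix.smul_apply, Matrix.sum_apply, smul_eq_mul, Finset.prod_mul_distrib,
    Finset.prod_const, Finset.card_univ, Fintype.card_fin, Finset.prod_univ_sum,
    Fintype.piFinset_univ, ketBra, vecMulVec_apply, tensorKet, Pi.star_apply, star_prod]

end Orthonormal

/-! ### Overlaps of the graph states -/

section Graph

variable {p m n : ℕ} [Fact p.Prime]

open Classical in
/-- The fraction of the points `r` at which `Q(r) + y = R(r) + z`. -/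
noncomputable def agreement (Q R : HiddenPoly p m n) (y z : ZMod p) : ℝ :=
  (Finset.univ.filter fun r : Fin m → ZMod p => Q.eval r + y = R.eval r + z).card / (p : ℝ) ^ m

lemma agreement_nonneg (Q R : HiddenPoly p m n) (y z : ZMod p) : 0 ≤ agreement Q R y z := by
  unfold agreement
  positivity

lemma prime_cast_pos (p : ℕ) [Fact p.Prime] : (0 : ℝ) < p :=
  Nat.cast_pos.2 (Fact.out : p.Prime).pos

lemma star_graphKet_dotProduct (Q R : HiddenPoly p m n) (y z : ZMod p) :
    star (graphKet Q y) ⬝ᵥ graphKet R z = (agreement Q R y z : ℂ) := by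
  classical
  have hp := prime_cast_pos p
  have hs : (1 / √((p : ℝ) ^ m)) * (1 / √((p : ℝ) ^ m)) = 1 / (p : ℝ) ^ m := by
    rw [div_mul_div_comm, Real.mul_self_sqrt (by positivity), one_mul]
  have h : ∀ r : Fin m → ZMod p, ∑ s, star (graphKet Q y) (r, s) * graphKet R z (r, s) =
      ((if Q.eval r + y = R.eval r + z then 1 / (p : ℝ) ^ m else 0 : ℝ) : ℂ) := fun r => by
    simp only [graphKet, Pi.star_apply, apply_ite star, star_zero, ite_mul, zero_mul,
      Finset.sum_ite_eq', Finset.mem_univ, if_true, Complex.star_def,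
      Complex.conj_ofReal, mul_ite, mul_zero, ← Complex.ofReal_mul, hs]
    by_cases h : Q.eval r + y = R.eval r + z
    · rw [if_pos h, if_pos h.symm]
    · rw [if_neg h, if_neg (Ne.symm h), Complex.ofReal_zero]
  rw [dotProduct, Fintype.sum_prod_type]
  simp_rw [h]
  rw [← Complex.ofReal_sum, ← Finset.sum_filter, Finset.sum_const, agreement, nsmul_eq_mul,
    mul_one_div]

lemma star_graphKet_dotProduct_self (Q : HiddenPoly p m n) (y z : ZMod p) :
    star (graphKet Q y) ⬝ᵥ graphKet Q z = if y = z then 1 else 0 := by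
  have hp := prime_cast_pos p
  rw [star_graphKet_dotProduct, agreement]
  split_ifs with h
  · subst h
    simp [hp.ne']
  · simp [h]

/-- The translates of the graph of `R` partition the graph of a translate of `Q`. -/
lemma sum_agreement (Q R : HiddenPoly p m n) (z : ZMod p) : ∑ y, agreement R Q y z = 1 := by
  classical
  have hp := prime_cast_pos p
  have hset : ∀ r y, R.eval r + y = Q.eval r + z ↔ Q.eval r + z - R.eval r = y := fun r y => by
    rw [sub_eq_iff_eq_add', eq_comm]
  simp only [agreement, hset]
  rw [← Finset.sum_div, div_eq_one_iff_eq (by positivity), ← Nat.cast_sum,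
    ← Finset.card_eq_sum_card_fiberwise
      (f := fun r : Fin m → ZMod p => Q.eval r + z - R.eval r) (s := Finset.univ)
      (t := Finset.univ) (by simp)]
  simp

/-- Two different polynomials without constant term have no common translate, so the
Schwartz-Zippel lemma applies to the difference of any two of their translates. -/
lemma agreement_le {Q R : HiddenPoly p m n} (h : Q ≠ R) (y z : ZMod p) :
    agreement Q R y z ≤ n / p := by
  classical
  set F : MvPolynomial (Fin m) (ZMod p) := Q.1 - R.1 + MvPolynomial.C (y - z) with hF
  have hF0 : F ≠ 0 := by
    intro h0
    have hc := congrArg MvPolynomial.constantCoeff h0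
    simp only [hF, map_add, map_sub, Q.2.2, R.2.2, MvPolynomial.constantCoeff_C, map_zero,
      sub_zero, zero_add] at hc
    rw [hF, hc, MvPolynomial.C_0, add_zero, sub_eq_zero] at h0
    exact h (Subtype.ext h0)
  have hdeg : F.totalDegree ≤ n := by
    refine (MvPolynomial.totalDegree_add _ _).trans (max_le ?_ ?_)
    · exact (MvPolynomial.totalDegree_sub _ _).trans (max_le Q.2.1 R.2.1)
    · rw [MvPolynomial.totalDegree_C]
      exact Nat.zero_le n
  have hsz := MvPolynomial.schwartz_zippel_totalDegree hF0 (Finset.univ : Finset (ZMod p))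
  rw [Fintype.piFinset_univ, Finset.card_univ, ZMod.card] at hsz
  have hset : (Finset.univ.filter fun r : Fin m → ZMod p => Q.eval r + y = R.eval r + z) =
      Finset.univ.filter fun r => MvPolynomial.eval r F = 0 := by
    refine Finset.filter_congr fun r _ => ?_
    simp only [hF, map_add, map_sub, MvPolynomial.eval_C, HiddenPoly.eval]
    constructor <;> intro h' <;> linear_combination h'
  have hp := prime_cast_pos p
  have hsz' : ((Finset.univ.filter fun r => MvPolynomial.eval r F = 0).card : ℝ) / (p : ℝ) ^ m ≤
      F.totalDegree / p := by
    have h' := (NNRat.cast_le (K := ℝ)).2 hsz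
    push_cast at h'
    exact h'
  rw [agreement, hset]
  refine hsz'.trans ?_
  gcongr

lemma sum_norm_star_graphKet_dotProduct_sq_le {Q R : HiddenPoly p m n} (h : R ≠ Q) (z : ZMod p) :
    ∑ y, ‖star (graphKet R y) ⬝ᵥ graphKet Q z‖ ^ 2 ≤ n / p := by
  have hle : ∀ y, ‖star (graphKet R y) ⬝ᵥ graphKet Q z‖ ^ 2 ≤ n / p * agreement R Q y z := by
    intro y
    rw [star_graphKet_dotProduct, Complex.norm_real, Real.norm_eq_abs, sq_abs, sq]
    exact mul_le_mul_of_nonneg_right (agreement_le h y z) (agreement_nonneg _ _ _ _)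
  refine (Finset.sum_le_sum fun y _ => hle y).trans_eq ?_
  rw [← Finset.mul_sum, sum_agreement, mul_one]

/-- The pure state `|φ_{Q,z₁}⟩ ⊗ ⋯ ⊗ |φ_{Q,z_k}⟩`. -/
noncomputable def graphTensor {k : ℕ} (Q : HiddenPoly p m n) (z : Fin k → ZMod p) :
    (Fin k → GraphSpace p m) → ℂ :=
  tensorKet fun i => graphKet Q (z i)

/-- The projection onto the support of `ρ_Q^{⊗k}`. -/
noncomputable def graphProj (k : ℕ) (Q : HiddenPoly p m n) :
    Matrix (Fin k → GraphSpace p m) (Fin k → GraphSpace p m) ℂ :=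
  ∑ z : Fin k → ZMod p, ketBra (graphTensor Q z)

lemma star_graphTensor_dotProduct_self {k : ℕ} (Q : HiddenPoly p m n) (y z : Fin k → ZMod p) :
    star (graphTensor Q y) ⬝ᵥ graphTensor Q z = if y = z then 1 else 0 :=
  star_tensorKet_dotProduct_of_orthonormal (star_graphKet_dotProduct_self Q) y z

lemma isStarProjection_graphProj (k : ℕ) (Q : HiddenPoly p m n) :
    IsStarProjection (graphProj k Q) :=
  isStarProjection_sum_ketBra (star_graphTensor_dotProduct_self Q)

lemma graphProj_mulVec_graphTensor {k : ℕ} (Q : HiddenPoly p m n) (z : Fin k → ZMod p) :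
    graphProj k Q *ᵥ graphTensor Q z = graphTensor Q z :=
  sum_ketBra_mulVec_self (star_graphTensor_dotProduct_self Q) z

lemma l2norm_graphTensor {k : ℕ} (Q : HiddenPoly p m n) (z : Fin k → ZMod p) :
    l2norm (graphTensor Q z) = 1 := by
  have h := l2norm_sq (graphTensor Q z)
  rw [star_graphTensor_dotProduct_self, if_pos rfl, Complex.one_re] at h
  exact (pow_eq_one_iff_of_nonneg (l2norm_nonneg _) two_ne_zero).1 h

lemma l2norm_graphProj_mulVec_le (l : ℕ) {Q R : HiddenPoly p m n} (h : R ≠ Q)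
    (z : Fin (2 * l) → ZMod p) :
    l2norm (graphProj (2 * l) R *ᵥ graphTensor Q z) ≤ (n / p : ℝ) ^ l := by
  have hp := prime_cast_pos p
  refine le_of_sq_le_sq ?_ (by positivity)
  rw [graphProj, l2norm_sum_ketBra_mulVec_sq (star_graphTensor_dotProduct_self R)]
  simp only [graphTensor, star_tensorKet_dotProduct, norm_prod, ← Finset.prod_pow]
  rw [← Fintype.piFinset_univ, ← Finset.prod_univ_sum (fun _ => Finset.univ)
    (fun i y => ‖star (graphKet R y) ⬝ᵥ graphKet Q (z i)‖ ^ 2)]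
  refine (Finset.prod_le_prod (fun i _ => Finset.sum_nonneg fun _ _ => sq_nonneg _)
    fun i _ => sum_norm_star_graphKet_dotProduct_sq_le h (z i)).trans_eq ?_
  rw [Finset.prod_const, Finset.card_univ, Fintype.card_fin, ← pow_mul, mul_comm]

end Graph

/-! ### The number of polynomials -/

lemma card_finsupp_degree_le (m n : ℕ) :
    Nat.card {d : Fin m →₀ ℕ // d.degree ≤ n} ≤ (n + m).choose m := by
  classical
  -- a slack variable turns the inequality into an equation
  have hmem : ∀ d : {d : Fin m →₀ ℕ // d.degree ≤ n}, Finsupp.cons (n - d.1.degree) d.1 ∈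
      Finset.finsuppAntidiag (Finset.univ : Finset (Fin (m + 1))) n := fun d => by
    have hd := d.2
    rw [Finsupp.degree_eq_sum] at hd
    simp only [Finset.mem_finsuppAntidiag, Fin.sum_univ_succ, Finsupp.cons_zero,
      Finsupp.cons_succ, Finset.subset_univ, and_true, Finsupp.degree_eq_sum]
    omega
  have hinj : Function.Injective fun d : {d : Fin m →₀ ℕ // d.degree ≤ n} =>
      (⟨_, hmem d⟩ : Finset.finsuppAntidiag (Finset.univ : Finset (Fin (m + 1))) n) := by
    intro d e h
    have h' := congrArg Finsupp.tail (Subtype.ext_iff.1 h)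
    simpa only [Finsupp.tail_cons, Subtype.ext_iff] using h'
  refine (Nat.card_le_card_of_injective _ hinj).trans_eq ?_
  rw [Nat.card_eq_fintype_card, Fintype.card_coe, Finset.card_finsuppAntidiag_nat_eq_choose,
    Finset.card_univ, Fintype.card_fin, ← Nat.choose_symm_add]
  congr 1
  omega

lemma card_hiddenPoly_le (p m n : ℕ) [Fact p.Prime] :
    Fintype.card (HiddenPoly p m n) ≤ p ^ (n + m).choose m := by
  have hfin : Finite {d : Fin m →₀ ℕ // d.degree ≤ n} :=
    (Finsupp.finite_of_degree_le n : {d : Fin m →₀ ℕ | d.degree ≤ n}.Finite)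
  have hinj : Function.Injective fun (Q : HiddenPoly p m n)
      (d : {d : Fin m →₀ ℕ // d.degree ≤ n}) => MvPolynomial.coeff d.1 Q.1 := by
    intro Q R h
    refine Subtype.ext (MvPolynomial.ext _ _ fun d => ?_)
    by_cases hd : d.degree ≤ n
    · exact congrFun h ⟨d, hd⟩
    · have hd' : n < ∑ i ∈ d.support, d i := not_le.mp hd
      rw [MvPolynomial.coeff_eq_zero_of_totalDegree_lt (Q.2.1.trans_lt hd'),
        MvPolynomial.coeff_eq_zero_of_totalDegree_lt (R.2.1.trans_lt hd')]
  rw [← Nat.card_eq_fintype_card]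
  refine (Nat.card_le_card_of_injective _ hinj).trans ?_
  rw [Nat.card_fun, Nat.card_zmod]
  exact Nat.pow_le_pow_right (Fact.out : p.Prime).pos (card_finsupp_degree_le m n)

/-! ### Identification of the polynomial from copies of its state -/

section Identification

variable {m n p : ℕ} [Fact p.Prime]

lemma HiddenPoly.nonempty (p m n : ℕ) : Nonempty (HiddenPoly p m n) := ⟨⟨0, by simp, by simp⟩⟩

/-- With `4 * D` copies, `D = (n + m).choose m`, every wrong projection shrinks the state by the
factor `(n / p) ^ (2 * D)`, while there are at most `p ^ D` polynomials. -/
theorem exists_povm_graphTensor (hp : 4 * n ^ (2 * (n + m).choose m) ≤ p) :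
    ∃ E : POVM (Fin (4 * (n + m).choose m) → GraphSpace p m) (HiddenPoly p m n),
      ∀ (Q : HiddenPoly p m n) (z : Fin (4 * (n + m).choose m) → ZMod p),
        1 / 2 ≤ E.prob (ketBra (graphTensor Q z)) Q := by
  classical
  have := HiddenPoly.nonempty p m n
  obtain ⟨E, hE⟩ := exists_povm_of_projections
    (isStarProjection_graphProj (p := p) (m := m) (n := n) (4 * (n + m).choose m))
  refine ⟨E, fun Q z => hE Q _ (graphProj_mulVec_graphTensor Q z) (l2norm_graphTensor Q z) ?_⟩
  generalize hD : (n + m).choose m = D at *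
  have hD1 : 1 ≤ D := hD ▸ Nat.choose_pos (Nat.le_add_left m n)
  have h4 : 4 * D = 2 * (2 * D) := by ring
  have hbound : ∀ R ∈ Finset.univ.erase Q,
      l2norm (graphProj (4 * D) R *ᵥ graphTensor Q z) ≤ (n / p : ℝ) ^ (2 * D) := by
    intro R hR
    revert z
    rw [h4]
    exact fun z => l2norm_graphProj_mulVec_le (2 * D) (Finset.ne_of_mem_erase hR) z
  have hp0 := prime_cast_pos p
  have hp1 : (1 : ℝ) ≤ p := Nat.one_le_cast.2 (Fact.out : p.Prime).one_lt.le
  have hcard : ((Finset.univ.erase Q).card : ℝ) ≤ (p : ℝ) ^ D := by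
    have h := (Finset.card_le_univ (Finset.univ.erase Q)).trans (card_hiddenPoly_le p m n)
    rw [hD] at h
    exact_mod_cast h
  have hp' : 4 * (n : ℝ) ^ (2 * D) ≤ p := by exact_mod_cast hp
  calc _ ≤ ∑ R ∈ Finset.univ.erase Q, (n / p : ℝ) ^ (2 * D) := by
        convert Finset.sum_le_sum hbound
    _ = (Finset.univ.erase Q).card * (n / p : ℝ) ^ (2 * D) := by
        rw [Finset.sum_const, nsmul_eq_mul]
    _ ≤ (p : ℝ) ^ D * (n / p : ℝ) ^ (2 * D) := by gcongr
    _ = (n : ℝ) ^ (2 * D) / (p : ℝ) ^ D := by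
        rw [div_pow, two_mul D, pow_add (p : ℝ)]
        field_simp
    _ ≤ (n : ℝ) ^ (2 * D) / p := by
        gcongr
        exact le_self_pow₀ hp1 (by omega)
    _ ≤ 1 / 4 := by
        rw [div_le_div_iff₀ hp0 (by norm_num)]
        linarith

lemma POVM.prob_tensorPower_polyState {Ω : Type} [Fintype Ω] {k : ℕ}
    (E : POVM (Fin k → GraphSpace p m) Ω) (Q : HiddenPoly p m n) (ω : Ω) :
    E.prob (tensorPower k (polyState Q)) ω =
      (1 / (p : ℝ)) ^ k * ∑ z : Fin k → ZMod p, E.prob (ketBra (graphTensor Q z)) ω := by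
  have h : ((1 / (p : ℂ)) ^ k) = (((1 / (p : ℝ)) ^ k : ℝ) : ℂ) := by push_cast; rfl
  simp only [POVM.prob, polyState, tensorPower_smul_sum_ketBra, smul_mul_assoc, trace_smul,
    Finset.sum_mul, trace_sum, smul_eq_mul, h, Complex.re_ofReal_mul, Complex.re_sum, graphTensor]

/-- A bound for all pure states `|φ_{Q,z₁}⟩ ⊗ ⋯ ⊗ |φ_{Q,z_k}⟩` passes to their average. -/
lemma le_average_of_forall_le {k : ℕ} {c : ℝ} {q : (Fin k → ZMod p) → ℝ} (h : ∀ z, c ≤ q z) :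
    c ≤ (1 / (p : ℝ)) ^ k * ∑ z, q z := by
  have hp := prime_cast_pos p
  have hsum : (p : ℝ) ^ k * c ≤ ∑ z, q z := by
    have := Finset.card_nsmul_le_sum Finset.univ q c fun z _ => h z
    simpa [ZMod.card] using this
  rw [one_div, inv_pow, inv_mul_eq_div, le_div_iff₀ (by positivity)]
  linarith

end Identification

/-! ### Unitary matrices and measurements of a subsystem -/

section Subsystem

variable {ι : Type} [Fintype ι] [DecidableEq ι]

/-- A unit vector extends to an orthonormal basis, the columns of the unitary. -/
lemma exists_unitary_mulVec_single {v : ι → ℂ} (hv : star v ⬝ᵥ v = 1) (i : ι) :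
    ∃ U : Matrix.unitaryGroup ι ℂ, (U : Matrix ι ι ℂ) *ᵥ Pi.single i 1 = v := by
  have hnorm : ‖WithLp.toLp 2 v‖ = 1 := by
    have h := l2norm_sq v
    rw [hv, Complex.one_re] at h
    exact (pow_eq_one_iff_of_nonneg (l2norm_nonneg _) two_ne_zero).1 h
  have hort : Orthonormal ℂ
      (({i} : Set ι).domRestrict fun _ : ι => (WithLp.toLp 2 v : EuclideanSpace ℂ ι)) :=
    ⟨fun _ => hnorm, fun a b hab => absurd (Subsingleton.elim a b) hab⟩
  obtain ⟨b, hb⟩ := hort.exists_orthonormalBasis_extension_of_card_eq (by simp)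
  refine ⟨⟨_, (EuclideanSpace.basisFun ι ℂ).toMatrix_orthonormalBasis_mem_unitary b⟩, ?_⟩
  ext j
  simp [Module.Basis.toMatrix_apply, hb i rfl]

lemma permMatrix_mem_unitaryGroup (σ : Equiv.Perm ι) :
    σ.permMatrix ℂ ∈ Matrix.unitaryGroup ι ℂ := by
  rw [mem_unitaryGroup_iff, star_eq_conjTranspose, conjTranspose_permMatrix, ← permMatrix_mul]
  simp

lemma POVM.prob_ketBra_smul {Ω : Type} [Fintype Ω] (E : POVM ι Ω) (c : ℂ) (ψ : ι → ℂ) (ω : Ω) :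
    E.prob (ketBra (c • ψ)) ω = ‖c‖ ^ 2 * E.prob (ketBra ψ) ω := by
  rw [E.prob_ketBra, E.prob_ketBra, mulVec_smul, dotProduct_smul, star_smul, smul_dotProduct,
    smul_eq_mul, smul_eq_mul, ← mul_assoc, Complex.star_def, Complex.mul_conj,
    Complex.re_ofReal_mul, Complex.normSq_eq_norm_sq]

open scoped ComplexOrder in
open scoped Kronecker in
/-- The measurement `E` of the first tensor factor of `ℂ^κ ≅ ℂ^ι ⊗ ℂ^α`. -/
noncomputable def POVM.onFactor {κ α Ω : Type} [Fintype κ] [DecidableEq κ] [Fintype α]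
    [DecidableEq α] [Fintype Ω] (E : POVM ι Ω) (e : κ ≃ ι × α) : POVM κ Ω where
  effect ω := (E.effect ω ⊗ₖ (1 : Matrix α α ℂ)).submatrix e e
  posSemidef ω := ((E.posSemidef ω).kronecker PosSemidef.one).submatrix e
  sum_eq_one := by
    ext a b
    have h := congrFun (congrFun E.sum_eq_one (e a).1) (e b).1
    rw [Matrix.sum_apply] at h
    simp only [Matrix.sum_apply, submatrix_apply, kroneckerMap_apply, ← Finset.sum_mul, h]
    simp only [one_apply, mul_ite, mul_one, mul_zero, ← ite_and]
    refine if_congr ?_ rfl rfl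
    rw [and_comm, ← Prod.ext_iff, e.apply_eq_iff_eq]

/-- Measuring a factor of a pure state amounts to measuring each of its slices. -/
lemma POVM.prob_onFactor {κ α Ω : Type} [Fintype κ] [DecidableEq κ] [Fintype α] [DecidableEq α]
    [Fintype Ω] (E : POVM ι Ω) (e : κ ≃ ι × α) (ψ : κ → ℂ) (ω : Ω) :
    (E.onFactor e).prob (ketBra ψ) ω =
      ∑ c : α, E.prob (ketBra fun a => ψ (e.symm (a, c))) ω := by
  simp only [POVM.prob_ketBra, ← Complex.re_sum]
  congr 1
  simp only [dotProduct, mulVec, POVM.onFactor, submatrix_apply, kroneckerMap_apply,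
    Pi.star_apply]
  rw [← e.symm.sum_comp, Fintype.sum_prod_type_right]
  refine Finset.sum_congr rfl fun c _ => Finset.sum_congr rfl fun a _ => ?_
  rw [← e.symm.sum_comp, Fintype.sum_prod_type]
  simp [one_apply]

end Subsystem

/-! ### Querying a uniform superposition in every slot -/

section Copies

variable {X Y Ω : Type}

/-- The exchange of the query and answer registers with the slot `i` of the workspace. -/
def swapSlot {k : ℕ} (i : Fin k) : Equiv.Perm (X × Y × (Fin k → X × Y)) :=
  Function.Involutive.toPerm
    (fun a => ((a.2.2 i).1, (a.2.2 i).2, Function.update a.2.2 i (a.1, a.2.1)))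
    (fun a => by simp)

lemma swapSlot_apply {k : ℕ} (i : Fin k) (x : X) (y : Y) (w : Fin k → X × Y) :
    swapSlot i (x, y, w) = ((w i).1, (w i).2, Function.update w i (x, y)) := rfl

variable [Fintype X] [DecidableEq Y]

/-- The state `|X|^(-1/2) ∑ₓ |x⟩ ⊗ |B x⟩`. -/
noncomputable def oracleKet (B : X → Y) : X × Y → ℂ :=
  fun a => if a.2 = B a.1 then ((1 / √(Fintype.card X : ℝ) : ℝ) : ℂ) else 0

lemma star_oracleKet_dotProduct_self [Fintype Y] [Nonempty X] (B : X → Y) :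
    star (oracleKet B) ⬝ᵥ oracleKet B = 1 := by
  have hs : (1 / √(Fintype.card X : ℝ)) * (1 / √(Fintype.card X : ℝ)) =
      1 / (Fintype.card X : ℝ) := by
    rw [div_mul_div_comm, Real.mul_self_sqrt (by positivity), one_mul]
  have h : ∀ x : X, ∑ y, star (oracleKet B) (x, y) * oracleKet B (x, y) =
      ((1 / (Fintype.card X : ℝ) : ℝ) : ℂ) := fun x => by
    simp only [oracleKet, Pi.star_apply, apply_ite star, star_zero, ite_mul, zero_mul,
      Finset.sum_ite_eq', Finset.mem_univ, if_true, Complex.star_def, Complex.conj_ofReal,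
      ← Complex.ofReal_mul, hs]
  rw [dotProduct, Fintype.sum_prod_type]
  simp_rw [h]
  simp

variable [AddGroup Y]

/-- The state of the algorithm after `j` queries: the first `j` slots of the workspace hold
answered queries, all other slots and the query register hold unanswered ones. -/
noncomputable def copyState {k : ℕ} (B : X → Y) (j : ℕ) : X × Y × (Fin k → X × Y) → ℂ :=
  fun a => oracleKet (fun _ : X => (0 : Y)) (a.1, a.2.1) *
    ∏ i : Fin k, oracleKet (if (i : ℕ) < j then B else fun _ => 0) (a.2.2 i)

/-- A query answers the unanswered state in the query register, and the exchange with slot `i`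
stores it there and fetches the next unanswered one. -/
lemma queryOp_copyState_swapSlot {k : ℕ} (B : X → Y) (i : Fin k)
    (a : X × Y × (Fin k → X × Y)) :
    queryOp B (copyState B i) (swapSlot i a) = copyState B (i + 1) a := by
  obtain ⟨x, y, w⟩ := a
  have h0 : oracleKet (fun _ : X => (0 : Y)) ((w i).1, (w i).2 - B (w i).1) =
      oracleKet B (w i) := by
    simp only [oracleKet, sub_eq_zero]
  simp only [queryOp, copyState, swapSlot_apply, h0]
  rw [← Finset.mul_prod_erase Finset.univ _ (Finset.mem_univ i),
    ← Finset.mul_prod_erase Finset.univ (fun i' : Fin k =>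
      oracleKet (if (i' : ℕ) < i + 1 then B else fun _ => 0) (w i')) (Finset.mem_univ i)]
  have hrest : ∏ i' ∈ Finset.univ.erase i, oracleKet
        (if (i' : ℕ) < i then B else fun _ => 0) (Function.update w i (x, y) i') =
      ∏ i' ∈ Finset.univ.erase i, oracleKet
        (if (i' : ℕ) < i + 1 then B else fun _ => 0) (w i') := by
    refine Finset.prod_congr rfl fun i' hi' => ?_
    have hne := Finset.ne_of_mem_erase hi'
    have hne' : (i' : ℕ) ≠ i := fun h => hne (Fin.ext h)
    rw [Function.update_of_ne hne]
    congr 1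
    exact if_congr (by omega) rfl rfl
  rw [hrest]
  simp only [Function.update_self, lt_irrefl, if_false, Nat.lt_succ_self, if_true]
  ring

variable [Fintype Y]

lemma star_copyState_zero_dotProduct_self [Nonempty X] {k : ℕ} (B : X → Y) :
    star (copyState (k := k) B 0) ⬝ᵥ copyState B 0 = 1 := by
  have h := star_oracleKet_dotProduct_self fun _ : X => (0 : Y)
  have hk : ∑ w : Fin k → X × Y, ∏ i, (star (oracleKet fun _ : X => (0 : Y)) (w i) *
      oracleKet (fun _ : X => (0 : Y)) (w i)) = 1 := by
    rw [← Fintype.piFinset_univ, ← Finset.prod_univ_sum (fun _ => Finset.univ)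
      (fun _ c => star (oracleKet fun _ : X => (0 : Y)) c * oracleKet (fun _ : X => (0 : Y)) c)]
    exact Finset.prod_eq_one fun _ _ => h
  have hprod : ∀ x y (w : Fin k → X × Y),
      star (copyState (k := k) B 0) (x, y, w) * copyState B 0 (x, y, w) =
        star (oracleKet fun _ : X => (0 : Y)) (x, y) * oracleKet (fun _ : X => (0 : Y)) (x, y) *
          ∏ i, (star (oracleKet fun _ : X => (0 : Y)) (w i) *
            oracleKet (fun _ : X => (0 : Y)) (w i)) := fun x y w => by
    simp only [copyState, Pi.star_apply, star_mul', star_prod, Finset.prod_mul_distrib,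
      Nat.not_lt_zero, if_false]
    ring
  rw [dotProduct, Fintype.sum_prod_type]
  simp_rw [Fintype.sum_prod_type (α₁ := Y), hprod, ← Finset.mul_sum, hk, mul_one]
  rw [← Fintype.sum_prod_type' fun x y => star (oracleKet fun _ : X => (0 : Y)) (x, y) *
    oracleKet (fun _ : X => (0 : Y)) (x, y)]
  exact h

variable [DecidableEq X] [Fintype Ω]

/-- The answered queries split into their arguments, which are measured, and everything else. -/
def splitArguments (X Y : Type) (k : ℕ) :
    X × Y × (Fin k → X × Y) ≃ (Fin k → X) × ((X × Y) × (Fin k → Y)) where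
  toFun a := (fun i => (a.2.2 i).1, (a.1, a.2.1), fun i => (a.2.2 i).2)
  invFun b := (b.2.1.1, b.2.1.2, fun i => (b.1 i, b.2.2 i))
  left_inv _ := rfl
  right_inv _ := rfl

/-- Before the first query the state does not depend on `B`, so a single unitary prepares it for all
black boxes. -/
lemma exists_unitary_copyState_zero [Nonempty X] (k : ℕ) (a : X × Y × (Fin k → X × Y)) :
    ∃ U : Matrix.unitaryGroup (X × Y × (Fin k → X × Y)) ℂ, ∀ B : X → Y,
      (U : Matrix (X × Y × (Fin k → X × Y)) (X × Y × (Fin k → X × Y)) ℂ) *ᵥ Pi.single a 1 =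
        copyState B 0 := by
  obtain ⟨U, hU⟩ := exists_unitary_mulVec_single
    (star_copyState_zero_dotProduct_self (k := k) fun _ : X => (0 : Y)) a
  exact ⟨U, fun B => hU.trans (by ext b; simp [copyState])⟩

/-- The algorithm that queries `k` uniform superpositions one after the other and then applies a
measurement to the arguments of the `k` answered queries.  The unitaries with index above `k` are
never used. -/
noncomputable def copyAlgorithm [Nonempty X] {k : ℕ} (E : POVM (Fin k → X) Ω) :
    QueryAlgorithm X Y Ω where
  Work := Fin k → X × Y
  queries := k
  start := (Classical.arbitrary X, 0, fun _ => (Classical.arbitrary X, 0))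
  unitary
    | 0 => (exists_unitary_copyState_zero k
        (Classical.arbitrary X, 0, fun _ => (Classical.arbitrary X, 0))).choose
    | j + 1 => if h : j < k then ⟨_, permMatrix_mem_unitaryGroup (swapSlot ⟨j, h⟩)⟩ else 1
  measurement := E.onFactor (splitArguments X Y k)

lemma stateAfter_copyAlgorithm [Nonempty X] {k : ℕ} (E : POVM (Fin k → X) Ω) (B : X → Y) {j : ℕ}
    (hj : j ≤ k) : (copyAlgorithm E).stateAfter B j = (copyState B j : X × Y × (Fin k → X × Y) → ℂ) := by
  induction j with
  | zero =>
    exact (exists_unitary_copyState_zero k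
      (Classical.arbitrary X, (0 : Y), fun _ => (Classical.arbitrary X, 0))).choose_spec B
  | succ j ih =>
    have h : j < k := hj
    rw [QueryAlgorithm.stateAfter, ih h.le]
    simp only [copyAlgorithm, dif_pos h]
    refine (permMatrix_mulVec (σ := swapSlot ⟨j, h⟩)).trans ?_
    exact funext fun a => queryOp_copyState_swapSlot B ⟨j, h⟩ a

lemma outputProb_copyAlgorithm [Nonempty X] {k : ℕ} (E : POVM (Fin k → X) Ω) (B : X → Y)
    (ω : Ω) : (copyAlgorithm E).outputProb B ω =
      ∑ y : Fin k → Y, E.prob (ketBra (tensorKet fun i x => oracleKet B (x, y i))) ω := by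
  have hstate : (copyAlgorithm E).stateAfter B k = (copyState B k : X × Y × (Fin k → X × Y) → ℂ) :=
    stateAfter_copyAlgorithm E B le_rfl
  have hslice : ∀ (c : X × Y) (y : Fin k → Y),
      (fun a => copyState (k := k) B k ((splitArguments X Y k).symm (a, c, y))) =
        oracleKet (fun _ : X => (0 : Y)) c • tensorKet fun i x => oracleKet B (x, y i) := by
    intro c y
    ext a
    simp [copyState, splitArguments, tensorKet]
  have hnorm : ∑ c, ‖oracleKet (fun _ : X => (0 : Y)) c‖ ^ 2 = 1 := by
    have h := l2norm_sq (oracleKet fun _ : X => (0 : Y))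
    rwa [star_oracleKet_dotProduct_self, Complex.one_re, l2norm, EuclideanSpace.norm_sq_eq] at h
  calc (copyAlgorithm E).outputProb B ω
      = (E.onFactor (splitArguments X Y k)).prob (ketBra (copyState B k)) ω := by
        rw [← hstate]; rfl
    _ = ∑ c, ‖oracleKet (fun _ : X => (0 : Y)) c‖ ^ 2 *
          ∑ y : Fin k → Y, E.prob (ketBra (tensorKet fun i x => oracleKet B (x, y i))) ω := by
        rw [POVM.prob_onFactor, Fintype.sum_prod_type]
        simp only [hslice, POVM.prob_ketBra_smul, Finset.mul_sum]
    _ = _ := by rw [← Finset.sum_mul, hnorm, one_mul]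

end Copies

/-! ### Black boxes that hide a polynomial -/

section Hiding

variable {p m n : ℕ} [Fact p.Prime]

/-- The value of a hiding function `B` on the graph of `Q + z`. -/
noncomputable def levelValue (B : GraphSpace p m → ZMod p) (Q : HiddenPoly p m n)
    (z : ZMod p) : ZMod p :=
  B (0, Q.eval 0 + z)

lemma Hides.levelValue_eq_iff {B : GraphSpace p m → ZMod p} {Q : HiddenPoly p m n}
    (h : Hides B Q) (a : GraphSpace p m) (z : ZMod p) :
    levelValue B Q z = B a ↔ a.2 = Q.eval a.1 + z := by
  refine (h 0 (Q.eval 0 + z) a.1 a.2).trans ⟨?_, fun ha => ⟨z, rfl, ha⟩⟩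
  rintro ⟨z', h0, ha⟩
  rw [ha, add_left_cancel h0]

lemma Hides.levelValue_bijective {B : GraphSpace p m → ZMod p} {Q : HiddenPoly p m n}
    (h : Hides B Q) : Function.Bijective (levelValue B Q) := by
  refine Finite.injective_iff_bijective.1 fun z z' hz => ?_
  exact (add_left_cancel ((h.levelValue_eq_iff (0, Q.eval 0 + z') z).1 hz)).symm

/-- Measuring the answer of a query on a uniform superposition leaves a graph state. -/
lemma Hides.oracleKet_levelValue {B : GraphSpace p m → ZMod p} {Q : HiddenPoly p m n}
    (h : Hides B Q) (z : ZMod p) : (fun a => oracleKet B (a, levelValue B Q z)) =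
      ((1 / √(p : ℝ) : ℝ) : ℂ) • graphKet Q z := by
  have hc : (1 / √(Fintype.card (GraphSpace p m) : ℝ)) = 1 / √(p : ℝ) * (1 / √((p : ℝ) ^ m)) := by
    rw [Fintype.card_prod, Fintype.card_fun, ZMod.card, Fintype.card_fin, div_mul_div_comm,
      one_mul, ← Real.sqrt_mul (Nat.cast_nonneg p), mul_comm (p : ℝ)]
    push_cast
    rfl
  ext a
  simp only [oracleKet, h.levelValue_eq_iff, graphKet, Pi.smul_apply, smul_eq_mul, hc]
  split_ifs <;> simp

lemma tensorKet_smul {ι : Type} {k : ℕ} (c : ℂ) (v : Fin k → ι → ℂ) :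
    (tensorKet fun i => c • v i) = c ^ k • tensorKet v := by
  ext a
  simp [tensorKet, Finset.prod_mul_distrib]

/-- One query of a hiding function produces one copy of the polynomial function state. -/
lemma Hides.outputProb_eq_prob_tensorPower {B : GraphSpace p m → ZMod p} {Q : HiddenPoly p m n}
    (h : Hides B Q) {Ω : Type} [Fintype Ω] {k : ℕ} (E : POVM (Fin k → GraphSpace p m) Ω) (ω : Ω) :
    (copyAlgorithm E).outputProb B ω = E.prob (tensorPower k (polyState Q)) ω := by
  have hc : ‖(((1 / √(p : ℝ) : ℝ) : ℂ)) ^ k‖ ^ 2 = (1 / (p : ℝ)) ^ k := by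
    rw [norm_pow, Complex.norm_real, Real.norm_eq_abs, ← pow_mul, mul_comm, pow_mul, sq_abs,
      div_pow, Real.sq_sqrt (Nat.cast_nonneg p), one_pow]
  have hbij : Function.Bijective fun (z : Fin k → ZMod p) i => levelValue B Q (z i) :=
    ⟨h.levelValue_bijective.1.comp_left, h.levelValue_bijective.2.comp_left⟩
  rw [outputProb_copyAlgorithm, ← hbij.sum_comp, E.prob_tensorPower_polyState,
    Finset.mul_sum]
  refine Finset.sum_congr rfl fun z _ => ?_
  have hz : (tensorKet fun i a => oracleKet B (a, levelValue B Q (z i))) =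
      (((1 / √(p : ℝ) : ℝ) : ℂ)) ^ k • graphTensor Q z :=
    (congrArg tensorKet (funext fun i => h.oracleKet_levelValue (z i))).trans
      (tensorKet_smul _ _)
  rw [hz, E.prob_ketBra_smul, hc]

end Hiding

theorem mainTheorem3 (m n : ℕ) :
    ∃ p₀ : ℕ, ∀ (p : ℕ) [Fact p.Prime], p₀ ≤ p →
      quantumQueryComplexity p m n ≤ ((4 * (n + m).choose m : ℕ) : ℕ∞) ∧
      ∃ E : POVM (Fin (4 * (n + m).choose m) → GraphSpace p m) (HiddenPoly p m n),
        ∀ Q : HiddenPoly p m n,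
          1 / 2 ≤ E.prob (tensorPower (4 * (n + m).choose m) (polyState Q)) Q := by
  refine ⟨4 * n ^ (2 * (n + m).choose m), fun p _ hp => ?_⟩
  obtain ⟨E, hE⟩ := exists_povm_graphTensor hp
  have hprob : ∀ Q : HiddenPoly p m n,
      1 / 2 ≤ E.prob (tensorPower (4 * (n + m).choose m) (polyState Q)) Q := fun Q => by
    rw [E.prob_tensorPower_polyState]
    exact le_average_of_forall_le (hE Q)
  refine ⟨iInf₂_le (copyAlgorithm E) fun Q B hB => ?_, E, hprob⟩
  rw [hB.outputProb_eq_prob_tensorPower]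
  exact hprob Q
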